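/- Let $\mathbb{Z}^+$ be the set of positive integers. For $A\subseteq\mathbb{Z}^+$ write $A(n)=A\cap\{1,2,\dots,n\}$, and let $\pi(n)$ be the number of primes not exceeding $n$. For an integer $h\ge 2$, a set $A\subseteq \mathbb{Z}^+$ has property $P_h$ if there are no $h+1$ distinct elements $a,a_1,\dots,a_h\in A$ such that $a$ divides the product $a_1a_2\cdots a_h$. (i) Let $h\ge 2$ and let $A\subseteq\mathbb{Z}^+$ have property $P_h$. Then for every real $\varepsilon>0$ $$\liminf_{n\to\infty}\frac{|A(n)|-\pi(n)}{n^{\varepsilon}}<\infty$$ (the limit inferior is taken in $[-\infty,\infty]$). (ii) There exists an absolute constant $c>0$ such that for every integer $h\ge 2$ there is a set $A\subseteq\mathbb{Z}^+$ with property $P_h$ for which $$|A(n)|\ge \pi(n)+\exp\left\{(\log n)^{1-\frac{c\sqrt{\log h}}{\sqrt{\log\log n}}}\right\}$$ holds for all sufficiently large integers $n$ (how large may depend on $h$ and $A$, while $c$ depends on neither). -/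

import Mathlib

open Filter

/-- Property `P_h`: there are no (pairwise) distinct elements `a, a₁, …, a_h` of `A`
such that `a` divides the product `a₁ ⋯ a_h`. The finset `s` is `{a₁, …, a_h}`. -/
def HasPropertyP (h : ℕ) (A : Set ℕ) : Prop :=
  ∀ a ∈ A, ∀ s : Finset ℕ, (s : Set ℕ) ⊆ A → s.card = h → a ∉ s → ¬ a ∣ ∏ b ∈ s, b

/-- The family `P_h(S)` of the subsets of `S` that possess property `P_h`. -/
def propertyPSets (h : ℕ) (S : Set ℕ) : Set (Set ℕ) :=
  {A | A ⊆ S ∧ HasPropertyP h A}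

/-- The positive integers, as a set of natural numbers. -/
def posInts : Set ℕ := {n | 0 < n}

/-- `|A(n)|`, where `A(n) = A ∩ {1, 2, …, n}`. -/
noncomputable def countUpTo (A : Set ℕ) (n : ℕ) : ℕ := (A ∩ Set.Icc 1 n).ncard

/-!
Both halves compare `A` with the primes that divide at least two of its elements.

For the upper bound let `A` be infinite with property `P_h`, and let `Q` be the set of primes
dividing at least two elements of `A`. An element with a prime factor outside `Q` is charged to that
prime, so the set `B` of the elements composed of primes of `Q` satisfies
`|A(n)| + |Q(n)| ≤ π(n) + |B(n)|` (`countUpTo_add_countUpTo_sharedPrimes_le`). If `b ∈ B` is a product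
of two coprime parts, then `P_h` forces one part to divide no other element of `A`
(`HasPropertyP.isPrivate_or`). For `b ≤ n` the parts can essentially be taken to be at most
`n ^ (2 / 3)`, which bounds `|B(n)|` by twice the number of integers up to `n ^ (2 / 3)` composed of
primes of `Q` (`countUpTo_inter_integersOver_le`). Unless `|A(n)| < π(n)` infinitely often,
`|Q(n)| ≤ |B(n)| + O(1)`; so if `|B(n)| = O(n ^ δ)`, then `Q` is sparse, Rankin's method bounds the
number of integers over `Q`, and `|B(n)| = O(n ^ (4 δ / 5))` follows. Starting from `δ = 1`, the
exponent becomes as small as desired (`exists_countUpTo_le_rpow`).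

For the lower bound the primes of a sparse set `Q` are replaced by more numerous products of them.
In a block of `k * 2 ^ m` primes of comparable logarithmic size, split into `k` classes, each word
of a Reed–Solomon code of length `k` selects one prime per class; with polynomials of degree at most
`D` and `k = h * D + 1`, two of the resulting products share at most `D` primes, so that no product
divides the product of `h` others (`hasPropertyP_of_card_primeFactors_inter_le`). There are
`2 ^ (m * (D + 1))` of them, enough to pay for a next block with `m * D` in place of `m`, whose primes
lie beyond all these products. The logarithm of the scale grows by the factor `4 * h * D` from block
to block but `m` only by `D`; with `H = 4 * h` and `D = H ^ (2 * j + 1)` in block `j`, this loss of a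
factor `H` per block, over about `√(log log n / log H)` blocks, yields the stated gain
(`exists_block`, `exp_log_rpow_le`).
-/

/-! ### Private divisors -/

lemma countUpTo_eq_card (A : Set ℕ) [DecidablePred (· ∈ A)] (n : ℕ) :
    countUpTo A n = ((Finset.Icc 1 n).filter (· ∈ A)).card := by
  rw [countUpTo, ← Set.ncard_coe_finset]
  congr 1
  ext a
  simp only [Set.mem_inter_iff, Set.mem_Icc, Finset.coe_filter, Finset.mem_Icc, Set.mem_ofPred_eq]
  tauto

/-- The primes dividing at least two elements of `A`. -/
def sharedPrimes (A : Set ℕ) : Set ℕ :=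
  {p | p.Prime ∧ ∃ a ∈ A, ∃ b ∈ A, a ≠ b ∧ p ∣ a ∧ p ∣ b}

/-- The positive integers all of whose prime factors lie in `Q`. -/
def integersOver (Q : Set ℕ) : Set ℕ := {u | 0 < u ∧ ∀ p, p.Prime → p ∣ u → p ∈ Q}

/-- `d` is private to `a` in `A`: no element of `A` other than `a` is a multiple of `d`. -/
def IsPrivate (A : Set ℕ) (a d : ℕ) : Prop := ∀ b ∈ A, d ∣ b → b = a

/-- The consequence of property `P_h` on which the upper bound rests. Coprimality of `u` and `v`
is needed: the two multiples may be one and the same element of `A`. -/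
lemma HasPropertyP.isPrivate_or {h : ℕ} {A : Set ℕ} (hA : HasPropertyP h A) (hh : 2 ≤ h)
    (hinf : A.Infinite) {a u v : ℕ} (ha : a ∈ A) (huv : u * v = a) (hco : u.Coprime v) :
    IsPrivate A a u ∨ IsPrivate A a v := by
  classical
  by_contra! hcon
  simp only [IsPrivate] at hcon
  push Not at hcon
  obtain ⟨⟨b, hb, hub, hba⟩, c, hc, hvc, hca⟩ := hcon
  have hinf' : (A \ ({a, b, c} : Finset ℕ)).Infinite := hinf.sdiff (Finset.finite_toSet _)
  obtain ⟨t, htA, htc⟩ := hinf'.exists_subset_card_eq (h - ({b, c} : Finset ℕ).card)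
  have hbc : ({b, c} : Finset ℕ).card ≤ 2 := Finset.card_le_two
  have hdisj : Disjoint ({b, c} : Finset ℕ) t := by
    rw [Finset.disjoint_left]
    intro x hx hxt
    have := (htA hxt).2
    simp at this hx
    tauto
  refine hA a ha ({b, c} ∪ t) ?_ ?_ ?_ ?_
  · intro x hx
    simp only [Finset.coe_union, Set.mem_union, Finset.mem_coe, Finset.mem_insert,
      Finset.mem_singleton] at hx
    rcases hx with (rfl | rfl) | hx
    · exact hb
    · exact hc
    · exact (htA hx).1
  · rw [Finset.card_union_of_disjoint hdisj, htc]
    omega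
  · intro hx
    simp only [Finset.mem_union, Finset.mem_insert, Finset.mem_singleton] at hx
    rcases hx with (rfl | rfl) | hx
    · exact hba rfl
    · exact hca rfl
    · have := (htA hx).2
      simp at this
  · rw [← huv]
    exact hco.mul_dvd_of_dvd_of_dvd (hub.trans (Finset.dvd_prod_of_mem _ (by simp)))
      (hvc.trans (Finset.dvd_prod_of_mem _ (by simp)))

/-- The elements of `A` having a private prime factor inject into the primes outside
`sharedPrimes A`. -/
lemma countUpTo_add_countUpTo_sharedPrimes_le {A : Set ℕ} (n : ℕ) :
    countUpTo A n + countUpTo (sharedPrimes A) n ≤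
      n.primeCounting + countUpTo (A ∩ integersOver (sharedPrimes A)) n := by
  classical
  simp only [countUpTo_eq_card]
  set Q := sharedPrimes A with hQ
  have h1 : ((Finset.Icc 1 n).filter (· ∈ A)).card =
      ((Finset.Icc 1 n).filter (· ∈ A ∩ integersOver Q)).card +
      ((Finset.Icc 1 n).filter (· ∈ A \ integersOver Q)).card := by
    rw [← Finset.card_union_of_disjoint]
    · congr 1
      ext a
      simp only [Finset.mem_filter, Finset.mem_union, Set.mem_inter_iff, Set.mem_sdiff]
      tauto
    · rw [Finset.disjoint_left]
      intro a h h'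
      simp only [Finset.mem_filter, Set.mem_inter_iff, Set.mem_sdiff] at h h'
      exact h'.2.2 h.2.2
  have h2 : n.primeCounting = ((Finset.Icc 1 n).filter (· ∈ Q)).card +
      ((Finset.Icc 1 n).filter (fun p => p.Prime ∧ p ∉ Q)).card := by
    rw [← Nat.primesLE_card_eq_primeCounting, ← Finset.card_union_of_disjoint]
    · congr 1
      ext p
      simp only [Nat.mem_primesLE, Finset.mem_filter, Finset.mem_union, Finset.mem_Icc]
      constructor
      · rintro ⟨h, h'⟩
        have := h'.one_lt
        by_cases hp : p ∈ Q
        · exact Or.inl ⟨⟨by omega, h⟩, hp⟩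
        · exact Or.inr ⟨⟨by omega, h⟩, h', hp⟩
      · rintro (⟨h, h'⟩ | ⟨h, h'⟩)
        · exact ⟨h.2, h'.1⟩
        · exact ⟨h.2, h'.1⟩
    · rw [Finset.disjoint_left]
      intro p h h'
      exact (Finset.mem_filter.1 h').2.2 (Finset.mem_filter.1 h).2
  have h3 : ((Finset.Icc 1 n).filter (· ∈ A \ integersOver Q)).card ≤
      ((Finset.Icc 1 n).filter (fun p => p.Prime ∧ p ∉ Q)).card := by
    refine Finset.card_le_card_of_forall_subsingleton (fun a p => p ∣ a) ?_ ?_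
    · intro a ha
      simp only [Finset.mem_filter, Finset.mem_Icc, Set.mem_sdiff] at ha
      obtain ⟨⟨ha1, han⟩, haA, haQ⟩ := ha
      have : ∃ p, p.Prime ∧ p ∣ a ∧ p ∉ Q := by
        by_contra! hcon
        exact haQ ⟨ha1, hcon⟩
      obtain ⟨p, hp, hpa, hpQ⟩ := this
      exact ⟨p, Finset.mem_filter.2 ⟨Finset.mem_Icc.2 ⟨hp.one_le,
        (Nat.le_of_dvd ha1 hpa).trans han⟩, hp, hpQ⟩, hpa⟩
    · intro p hp a ha b hb
      simp only [Finset.mem_filter] at hp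
      simp only [Finset.mem_filter, Set.mem_sdiff, Set.mem_ofPred_eq] at ha hb
      by_contra hab
      exact hp.2.2 ⟨hp.2.1, a, ha.1.2.1, b, hb.1.2.1, hab, ha.2, hb.2⟩
  omega

/-- A factorization of `b ≤ n` into coprime parts, each of them at most `n ^ (2 / 3)` unless it
is a prime power. -/
lemma exists_coprime_factorization {b n : ℕ} (hb : 0 < b) (hbn : b ≤ n) :
    ∃ u v, u * v = b ∧ u.Coprime v ∧ v ^ 3 ≤ n ^ 2 ∧
      (u ^ 3 ≤ n ^ 2 ∨ ∃ p, p.Prime ∧ p ∣ b ∧ u = p ^ b.factorization p) := by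
  classical
  -- `v` is the largest unitary divisor of `b` that is at most `n ^ (2 / 3)`
  let S := b.divisors.filter (fun v => v.Coprime (b / v) ∧ v ^ 3 ≤ n ^ 2)
  have hS : S.Nonempty := by
    refine ⟨1, Finset.mem_filter.2 ⟨by simp [hb.ne'], by simp, ?_⟩⟩
    have : 1 ≤ n := by omega
    simpa using Nat.one_le_pow 2 n this
  obtain ⟨v, hvS, hmax⟩ := S.exists_max_image id hS
  simp only [S, Finset.mem_filter, Nat.mem_divisors, id] at hvS hmax
  obtain ⟨⟨⟨u, hbu⟩, -⟩, hco, hv⟩ := hvS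
  have hv0 : 0 < v := Nat.pos_of_ne_zero (by rintro rfl; simp at hbu; omega)
  have hbv : b / v = u := by rw [hbu, Nat.mul_div_cancel_left _ hv0]
  rw [hbv] at hco
  by_cases hu : u ^ 3 ≤ n ^ 2
  · exact ⟨u, v, by rw [hbu, mul_comm], hco.symm, hv, Or.inl hu⟩
  have hu0 : u ≠ 0 := by rintro rfl; simp at hu
  have hu1 : u ≠ 1 := by
    rintro rfl
    apply hu
    have : 1 ≤ n := by omega
    simpa using Nat.one_le_pow 2 n this
  obtain ⟨p, hp, hpu⟩ := Nat.exists_prime_and_dvd hu1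
  have hpv : ¬ p ∣ v := fun hpv => hp.one_lt.ne' (Nat.dvd_one.1 (hco ▸ Nat.dvd_gcd hpv hpu))
  have hpb : p ∣ b := hbu ▸ hpu.mul_left v
  have hfac : b.factorization p = u.factorization p := by
    rw [hbu, Nat.factorization_mul hv0.ne' hu0]
    simp [Nat.factorization_eq_zero_of_not_dvd hpv]
  set q := p ^ b.factorization p with hq
  obtain ⟨w, hw⟩ : q ∣ u := by rw [hq, hfac]; exact Nat.ordProj_dvd u p
  have hqw : q.Coprime w := by
    have := Nat.coprime_ordCompl hp hu0
    rw [← hfac, ← hq] at this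
    have hw' : u / q = w := by
      rw [hw, Nat.mul_div_cancel_left _ (pow_pos hp.pos _)]
    rw [hw'] at this
    exact this.pow_left _
  have hq0 : 0 < q := pow_pos hp.pos _
  have hq1 : 1 < q := by
    refine Nat.one_lt_pow ?_ hp.one_lt
    exact (hp.factorization_pos_of_dvd hb.ne' hpb).ne'
  have hvq : n ^ 2 < (v * q) ^ 3 := by
    by_contra! hle
    have hvw : v.Coprime w := hco.coprime_dvd_right (hw ▸ Dvd.intro_left _ rfl)
    have := hmax (v * q) ⟨⟨⟨w, by rw [hbu, hw, mul_assoc]⟩, hb.ne'⟩, ?_, hle⟩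
    · nlinarith
    · have : b / (v * q) = w := by
        rw [hbu, hw, ← mul_assoc, Nat.mul_div_cancel_left _ (Nat.mul_pos hv0 hq0)]
      rw [this]
      exact hvw.mul_left hqw
  refine ⟨q, v * w, ?_, ?_, ?_, Or.inr ⟨p, hp, hpb, hq⟩⟩
  · rw [hbu, hw]; ring
  · refine Nat.Coprime.mul_right ?_ hqw
    exact (hco.coprime_dvd_right (hw ▸ Dvd.intro _ rfl)).symm
  · -- `u > n ^ (2 / 3)` gives `v ≤ n ^ (1 / 3)`, and maximality of `v` gives `v * q > n ^ (2 / 3)`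
    have hb3 : (v * u) ^ 3 ≤ n ^ 3 := Nat.pow_le_pow_left (hbu ▸ hbn) 3
    have hn2 : 0 < n ^ 2 := by have : 0 < n := by omega
                               positivity
    have e1 : v ^ 3 * n ^ 2 ≤ n * n ^ 2 := by
      calc v ^ 3 * n ^ 2 ≤ v ^ 3 * u ^ 3 := Nat.mul_le_mul_left _ (by omega)
        _ = (v * u) ^ 3 := by ring
        _ ≤ n ^ 3 := hb3
        _ = n * n ^ 2 := by ring
    have e2 : v ^ 3 ≤ n := Nat.le_of_mul_le_mul_right e1 hn2
    have e3 : n ^ 2 * (v * w) ^ 3 ≤ n ^ 2 * n ^ 2 := by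
      calc n ^ 2 * (v * w) ^ 3 ≤ (v * q) ^ 3 * (v * w) ^ 3 := Nat.mul_le_mul_right _ hvq.le
        _ = (v * (q * w)) ^ 3 * v ^ 3 := by ring
        _ ≤ n ^ 3 * n := Nat.mul_le_mul (hw ▸ hb3) e2
        _ = n ^ 2 * n ^ 2 := by ring
    exact Nat.le_of_mul_le_mul_left e3 hn2

lemma mem_integersOver_of_dvd {Q : Set ℕ} {a d : ℕ} (ha : a ∈ integersOver Q) (hd : d ∣ a) :
    d ∈ integersOver Q :=
  ⟨Nat.pos_of_dvd_of_pos hd ha.1, fun p hp hpd => ha.2 p hp (hpd.trans hd)⟩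

/-- An element of `A ∩ integersOver (sharedPrimes A)` is determined by a private divisor that is
at most `n ^ (2 / 3)`, or else by a prime whose exponent is larger in it than in any other element
of `A`. That exponent is at least `2` because the prime is shared, which makes the prime at most
`n ^ (1 / 2)`. -/
lemma countUpTo_inter_integersOver_le {h : ℕ} {A : Set ℕ} (hA : HasPropertyP h A) (hh : 2 ≤ h)
    (hinf : A.Infinite) (n : ℕ) :
    ∃ F : Finset ℕ, (∀ u ∈ F, u ∈ integersOver (sharedPrimes A) ∧ u ^ 3 ≤ n ^ 2) ∧
      countUpTo (A ∩ integersOver (sharedPrimes A)) n ≤ 2 * F.card := by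
  classical
  simp only [countUpTo_eq_card]
  set Q := sharedPrimes A with hQ
  let F := (Finset.Icc 1 (n ^ 2)).filter (fun u => u ∈ integersOver Q ∧ u ^ 3 ≤ n ^ 2)
  have hmemF : ∀ u, u ∈ integersOver Q → u ^ 3 ≤ n ^ 2 → u ∈ F := fun u h1 h2 =>
    Finset.mem_filter.2 ⟨Finset.mem_Icc.2 ⟨h1.1, (Nat.le_self_pow three_ne_zero u).trans h2⟩, h1, h2⟩
  refine ⟨F, fun u hu => (Finset.mem_filter.1 hu).2, ?_⟩
  set B := (Finset.Icc 1 n).filter (· ∈ A ∩ integersOver Q) with hB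
  let B₁ := B.filter (fun b => ∃ d ∈ F, d ∣ b ∧ IsPrivate A b d)
  let B₂ := B.filter (fun b => ∃ p ∈ F, p.Prime ∧ IsPrivate A b (p ^ b.factorization p))
  have hsub : B ⊆ B₁ ∪ B₂ := by
    intro b hbB
    have hb' := hbB
    simp only [hB, Finset.mem_filter, Finset.mem_Icc, Set.mem_inter_iff] at hb'
    obtain ⟨⟨hb1, hbn⟩, hbA, hbQ⟩ := hb'
    obtain ⟨u, v, huv, hco, hv, hu⟩ := exists_coprime_factorization hb1 hbn
    have hub : u ∣ b := huv ▸ Dvd.intro _ rfl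
    have hvb : v ∣ b := huv ▸ Dvd.intro_left _ rfl
    rw [Finset.mem_union]
    rcases hA.isPrivate_or hh hinf hbA huv hco with hup | hvp
    · rcases hu with hu | ⟨p, hp, hpb, hup'⟩
      · exact Or.inl (Finset.mem_filter.2 ⟨hbB, u,
          hmemF u (mem_integersOver_of_dvd hbQ hub) hu, hub, hup⟩)
      · refine Or.inr (Finset.mem_filter.2 ⟨hbB, p,
          hmemF p (mem_integersOver_of_dvd hbQ hpb) ?_, hp, hup' ▸ hup⟩)
        obtain ⟨-, a₁, ha₁, a₂, ha₂, hne, hpa₁, hpa₂⟩ := hbQ.2 p hp hpb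
        have hne1 : b.factorization p ≠ 1 := by
          intro h1
          rw [hup', h1, pow_one] at hup
          exact hne ((hup a₁ ha₁ hpa₁).trans (hup a₂ ha₂ hpa₂).symm)
        have hpos := hp.factorization_pos_of_dvd (Nat.pos_iff_ne_zero.1 hb1) hpb
        have hp2 : p ^ 2 ≤ n := by
          calc p ^ 2 ≤ p ^ b.factorization p := Nat.pow_le_pow_right hp.pos (by omega)
            _ ≤ b := Nat.le_of_dvd hb1 (hup' ▸ hub)
            _ ≤ n := hbn
        calc p ^ 3 ≤ p ^ 4 := Nat.pow_le_pow_right hp.pos (by norm_num)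
          _ = (p ^ 2) ^ 2 := by ring
          _ ≤ n ^ 2 := Nat.pow_le_pow_left hp2 2
    · exact Or.inl (Finset.mem_filter.2 ⟨hbB, v,
        hmemF v (mem_integersOver_of_dvd hbQ hvb) hv, hvb, hvp⟩)
  have hmemA : ∀ b ∈ B, b ∈ A := fun b hb => (Finset.mem_filter.1 hb).2.1
  have h₁ : B₁.card ≤ F.card := by
    refine Finset.card_le_card_of_forall_subsingleton (fun b d => d ∣ b ∧ IsPrivate A b d) ?_ ?_
    · intro b hb
      exact (Finset.mem_filter.1 hb).2
    · rintro d - b ⟨hb, hdb, hbp⟩ b' ⟨hb', hdb', hbp'⟩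
      exact hbp' b (hmemA b (Finset.mem_filter.1 hb).1) hdb
  have h₂ : B₂.card ≤ F.card := by
    refine Finset.card_le_card_of_forall_subsingleton
      (fun b p => p.Prime ∧ IsPrivate A b (p ^ b.factorization p)) ?_ ?_
    · intro b hb
      exact (Finset.mem_filter.1 hb).2
    · rintro p - b ⟨hb, hp, hbp⟩ b' ⟨hb', -, hbp'⟩
      -- the two exponents of `p` are comparable
      rcases le_total (b.factorization p) (b'.factorization p) with hle | hle
      · exact (hbp b' (hmemA b' (Finset.mem_filter.1 hb').1)
          ((pow_dvd_pow p hle).trans (Nat.ordProj_dvd b' p))).symm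
      · exact hbp' b (hmemA b (Finset.mem_filter.1 hb).1)
          ((pow_dvd_pow p hle).trans (Nat.ordProj_dvd b p))
  have := (Finset.card_le_card hsub).trans (Finset.card_union_le _ _)
  omega

/-! ### Rankin's method and the upper bound -/

lemma summable_rpow_of_countUpTo_le {Q : Set ℕ} {C δ s : ℝ} (hδ : 0 < δ) (hs : δ < s)
    (hC : 0 ≤ C) (hQ0 : 0 ∉ Q) (hQ : ∀ n : ℕ, 1 ≤ n → (countUpTo Q n : ℝ) ≤ C * (n : ℝ) ^ δ) :
    Summable (fun q : Q => ((q : ℕ) : ℝ) ^ (-s)) := by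
  classical
  -- the `k`-th element `q` of `Q` satisfies `k ≤ C q ^ δ`, so `q ^ (-s) ≤ (C / k) ^ (s / δ)`
  have hinj : Function.Injective (fun q : Q => countUpTo Q (q : ℕ)) := by
    intro p q hpq
    simp only [countUpTo_eq_card] at hpq
    by_contra hne
    have key : ∀ p q : Q, (p : ℕ) < q →
        ((Finset.Icc 1 (p : ℕ)).filter (· ∈ Q)).card < ((Finset.Icc 1 (q : ℕ)).filter (· ∈ Q)).card := by
      intro p q hlt
      refine Finset.card_lt_card (Finset.ssubset_iff_subset_ne.2 ⟨?_, ?_⟩)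
      · intro a ha
        simp only [Finset.mem_filter, Finset.mem_Icc] at ha ⊢
        exact ⟨⟨ha.1.1, by omega⟩, ha.2⟩
      · intro heq
        have : (q : ℕ) ∈ (Finset.Icc 1 (q : ℕ)).filter (· ∈ Q) := by
          simp only [Finset.mem_filter, Finset.mem_Icc]
          exact ⟨⟨by omega, le_rfl⟩, q.2⟩
        rw [← heq] at this
        simp only [Finset.mem_filter, Finset.mem_Icc] at this
        omega
    rcases lt_or_gt_of_ne (fun h => hne (Subtype.ext h)) with h | h
    · exact absurd hpq (key _ _ h).ne
    · exact absurd hpq (key _ _ h).ne'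
  have hr : 1 < s / δ := (one_lt_div hδ).2 hs
  have hsum : Summable (fun k : ℕ => C ^ (s / δ) * (k : ℝ) ^ (-(s / δ))) :=
    (Real.summable_nat_rpow.2 (by linarith)).mul_left _
  refine Summable.of_nonneg_of_le (fun q => by positivity) (fun q => ?_)
    (hsum.comp_injective hinj)
  have hq : 1 ≤ (q : ℕ) := Nat.one_le_iff_ne_zero.2 (fun h => hQ0 (h ▸ q.2))
  have hq' : (0 : ℝ) < (q : ℕ) := by exact_mod_cast hq
  have hk : 1 ≤ countUpTo Q (q : ℕ) := by
    rw [countUpTo_eq_card]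
    exact Finset.card_pos.2 ⟨q, by
      simp only [Finset.mem_filter, Finset.mem_Icc]; exact ⟨⟨hq, le_rfl⟩, q.2⟩⟩
  have hk' : (0 : ℝ) < (countUpTo Q (q : ℕ) : ℝ) := by exact_mod_cast hk
  have h1 := Real.rpow_le_rpow hk'.le (hQ q hq) (by positivity : 0 ≤ s / δ)
  rw [Real.mul_rpow hC (by positivity), ← Real.rpow_mul hq'.le, mul_div_cancel₀ _ hδ.ne'] at h1
  simp only [Function.comp_apply]
  rw [Real.rpow_neg hq'.le, Real.rpow_neg hk'.le, ← div_eq_mul_inv, inv_eq_one_div,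
    div_le_div_iff₀ (by positivity) (by positivity)]
  linarith

/-- Rankin's method: a set of primes with counting function `O(n ^ δ)` generates only
`O(x ^ s)` integers up to `x`, for each `s > δ`. -/
lemma exists_card_integersOver_le {Q : Set ℕ} (hQp : ∀ q ∈ Q, q.Prime) {C δ s : ℝ} (hδ : 0 < δ)
    (hs : δ < s) (hC : 0 ≤ C) (hQ : ∀ n : ℕ, 1 ≤ n → (countUpTo Q n : ℝ) ≤ C * (n : ℝ) ^ δ) :
    ∃ K : ℝ, 0 ≤ K ∧ ∀ (F : Finset ℕ) (x : ℝ), 0 ≤ x → (∀ u ∈ F, u ∈ integersOver Q ∧ (u : ℝ) ≤ x) →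
      (F.card : ℝ) ≤ K * x ^ s := by
  classical
  have hs0 : 0 < s := hδ.trans hs
  have hsum := summable_rpow_of_countUpTo_le hδ hs hC
    (fun h0 => Nat.not_prime_zero (hQp 0 h0)) hQ
  set T := ∑' q : Q, ((q : ℕ) : ℝ) ^ (-s) with hT
  set c : ℝ := (1 - (2 : ℝ) ^ (-s))⁻¹ with hc
  have h2s : (2 : ℝ) ^ (-s) < 1 := Real.rpow_lt_one_of_one_lt_of_neg one_lt_two (by linarith)
  have hc0 : 0 < c := inv_pos.2 (by linarith)
  let f : ℕ →* ℝ :=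
    { toFun := fun n => (n : ℝ) ^ (-s)
      map_one' := by simp
      map_mul' := fun a b => by
        push_cast
        exact Real.mul_rpow (by positivity) (by positivity) }
  have hf : ∀ n : ℕ, f n = (n : ℝ) ^ (-s) := fun n => rfl
  have hf0 : ∀ n : ℕ, 0 ≤ f n := fun n => by rw [hf]; positivity
  have hf2 : ∀ {p : ℕ}, p.Prime → f p ≤ (2 : ℝ) ^ (-s) := by
    intro p hp
    rw [hf]
    exact Real.rpow_le_rpow_of_nonpos two_pos (by exact_mod_cast hp.two_le) (by linarith)
  have hf1 : ∀ {p : ℕ}, p.Prime → ‖f p‖ < 1 := by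
    intro p hp
    rw [Real.norm_of_nonneg (hf0 p)]
    exact (hf2 hp).trans_lt h2s
  refine ⟨Real.exp (c * T), (Real.exp_pos _).le, fun F x hx hF => ?_⟩
  set P : Finset ℕ := (F.biUnion Nat.primeFactors) with hP
  have hPQ : ∀ p ∈ P, p ∈ Q := by
    intro p hp
    obtain ⟨u, hu, hpu⟩ := Finset.mem_biUnion.1 hp
    exact (hF u hu).1.2 p (Nat.prime_of_mem_primeFactors hpu) (Nat.dvd_of_mem_primeFactors hpu)
  have hFP : ∀ u ∈ F, u ∈ Nat.factoredNumbers P := fun u hu =>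
    Nat.mem_factoredNumbers_of_primeFactors_subset (hF u hu).1.1.ne'
      (Finset.subset_biUnion_of_mem Nat.primeFactors hu)
  obtain ⟨-, hprod⟩ :=
    EulerProduct.summable_and_hasSum_factoredNumbers_prod_filter_prime_geometric hf1 P
  have h1 : ∑ u ∈ F, f u ≤ ∏ p ∈ P with p.Prime, (1 - f p)⁻¹ := by
    have := sum_le_hasSum (F.subtype (· ∈ Nat.factoredNumbers P)) (fun m _ => hf0 m) hprod
    rwa [Finset.sum_subtype_of_mem (fun u => f u) hFP] at this
  have h2 : ∏ p ∈ P with p.Prime, (1 - f p)⁻¹ ≤ Real.exp (c * T) := by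
    calc ∏ p ∈ P with p.Prime, (1 - f p)⁻¹
        ≤ ∏ p ∈ P with p.Prime, Real.exp (c * f p) := by
          refine Finset.prod_le_prod (fun p hp => ?_) (fun p hp => ?_)
          · have := hf2 (Finset.mem_filter.1 hp).2
            exact inv_nonneg.2 (by linarith)
          · have hle := hf2 (Finset.mem_filter.1 hp).2
            have hpos : 0 < 1 - f p := by linarith
            have h3 : (1 - f p)⁻¹ ≤ c := inv_anti₀ (by linarith) (by linarith)
            have h4 : (1 - f p)⁻¹ = 1 + (1 - f p)⁻¹ * f p := by field_simp; ring
            have h5 := mul_le_mul_of_nonneg_right h3 (hf0 p)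
            have h6 := Real.add_one_le_exp (c * f p)
            linarith
      _ = Real.exp (c * ∑ p ∈ P with p.Prime, f p) := by
          rw [← Real.exp_sum, Finset.mul_sum]
      _ ≤ Real.exp (c * T) := by
          refine Real.exp_le_exp.2 (mul_le_mul_of_nonneg_left ?_ hc0.le)
          have h7 : ∀ p ∈ P.filter Nat.Prime, p ∈ Q := fun p hp =>
            hPQ p (Finset.mem_filter.1 hp).1
          have := hsum.sum_le_tsum ((P.filter Nat.Prime).subtype (· ∈ Q))
            (fun q _ => hf0 q)
          rwa [Finset.sum_subtype_of_mem (fun p => f p) h7] at this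
  have h3 : ∀ u ∈ F, 1 ≤ f u * x ^ s := by
    intro u hu
    have hu0 : (0 : ℝ) < u := by exact_mod_cast (hF u hu).1.1
    rw [hf, Real.rpow_neg hu0.le, inv_mul_eq_div, one_le_div (by positivity)]
    exact Real.rpow_le_rpow hu0.le (hF u hu).2 hs0.le
  calc (F.card : ℝ) = ∑ u ∈ F, (1 : ℝ) := by simp
    _ ≤ ∑ u ∈ F, f u * x ^ s := Finset.sum_le_sum h3
    _ = (∑ u ∈ F, f u) * x ^ s := by rw [Finset.sum_mul]
    _ ≤ Real.exp (c * T) * x ^ s :=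
        mul_le_mul_of_nonneg_right (h1.trans h2) (Real.rpow_nonneg hx s)

/-- The counting function `β` of `A ∩ integersOver (sharedPrimes A)` is `O(n ^ ((4 / 5) ^ k))` for
every `k`. A bound `β(n) = O(n ^ δ)` carries over to the shared primes, hence the integers over them
number `O(x ^ (6 δ / 5))` up to `x`, and taking `x = n ^ (2 / 3)` gives `β(n) = O(n ^ (4 δ / 5))`. -/
lemma exists_countUpTo_le_rpow {h : ℕ} {A : Set ℕ} (hA : HasPropertyP h A) (hh : 2 ≤ h)
    (hinf : A.Infinite) {C₀ : ℝ} (hC₀ : ∀ n : ℕ, (countUpTo (sharedPrimes A) n : ℝ) ≤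
      countUpTo (A ∩ integersOver (sharedPrimes A)) n + C₀) (k : ℕ) :
    ∃ C : ℝ, 0 ≤ C ∧ ∀ n : ℕ, 1 ≤ n →
      (countUpTo (A ∩ integersOver (sharedPrimes A)) n : ℝ) ≤ C * (n : ℝ) ^ ((4 / 5 : ℝ) ^ k) := by
  induction k with
  | zero =>
    refine ⟨1, zero_le_one, fun n hn => ?_⟩
    classical
    rw [countUpTo_eq_card, pow_zero, Real.rpow_one, one_mul]
    exact_mod_cast (Finset.card_filter_le _ _).trans (by simp)
  | succ k ih =>
    obtain ⟨C, hC, hB⟩ := ih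
    set δ : ℝ := (4 / 5 : ℝ) ^ k with hδ
    have hδ0 : 0 < δ := by positivity
    have hQ : ∀ n : ℕ, 1 ≤ n →
        (countUpTo (sharedPrimes A) n : ℝ) ≤ (C + |C₀|) * (n : ℝ) ^ δ := by
      intro n hn
      have h1 : (1 : ℝ) ≤ (n : ℝ) ^ δ :=
        Real.one_le_rpow (by exact_mod_cast hn) hδ0.le
      have h2 : C₀ ≤ |C₀| * (n : ℝ) ^ δ :=
        (le_abs_self _).trans (le_mul_of_one_le_right (abs_nonneg _) h1)
      linarith [hB n hn, hC₀ n]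
    obtain ⟨K, hK, hF⟩ := exists_card_integersOver_le (fun q hq => hq.1) hδ0
      (by linarith : δ < 6 / 5 * δ) (by positivity) hQ
    refine ⟨2 * K, by positivity, fun n hn => ?_⟩
    obtain ⟨F, hFn, hle⟩ := countUpTo_inter_integersOver_le hA hh hinf n
    have hn0 : (0 : ℝ) ≤ n := Nat.cast_nonneg n
    have hcard := hF F ((n : ℝ) ^ (2 / 3 : ℝ)) (by positivity) (fun u hu => ⟨(hFn u hu).1, by
      refine le_of_pow_le_pow_left₀ three_ne_zero (by positivity) ?_
      rw [← Real.rpow_mul_natCast hn0]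
      norm_num
      exact_mod_cast (hFn u hu).2⟩)
    rw [← Real.rpow_mul hn0] at hcard
    have he : (4 / 5 : ℝ) ^ (k + 1) = 2 / 3 * (6 / 5 * δ) := by rw [pow_succ]; ring
    rw [he]
    have : (countUpTo (A ∩ integersOver (sharedPrimes A)) n : ℝ) ≤ 2 * F.card := by
      exact_mod_cast hle
    linarith

theorem liminf_countUpTo_sub_primeCounting_lt_top {h : ℕ} (hh : 2 ≤ h) {A : Set ℕ}
    (hA : HasPropertyP h A) {ε : ℝ} (hε : 0 < ε) :
    liminf (fun n : ℕ =>
      ((((countUpTo A n : ℝ) - (Nat.primeCounting n : ℝ)) / (n : ℝ) ^ ε : ℝ) : EReal)) atTop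
      < ⊤ := by
  -- it suffices to bound the quotient for infinitely many `n`
  suffices hfreq : ∃ C : ℝ, ∃ᶠ n : ℕ in atTop,
      ((countUpTo A n : ℝ) - (Nat.primeCounting n : ℝ)) / (n : ℝ) ^ ε ≤ C by
    obtain ⟨C, hC⟩ := hfreq
    refine (liminf_le_of_frequently_le' (hC.mono fun n hn => ?_)).trans_lt (EReal.coe_lt_top C)
    exact EReal.coe_le_coe_iff.2 hn
  -- if `|A(n)| < π(n)` infinitely often, then `C = 0` does; otherwise the shared primes are few
  by_cases hev : ∀ᶠ n : ℕ in atTop, n.primeCounting ≤ countUpTo A n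
  swap
  · refine ⟨0, (not_eventually.1 hev).mono fun n hn => ?_⟩
    refine div_nonpos_of_nonpos_of_nonneg ?_ (by positivity)
    rw [sub_nonpos]
    exact_mod_cast (not_le.1 hn).le
  have hinf : A.Infinite := by
    intro hfin
    have h1 := hev.and (Nat.tendsto_primeCounting.eventually_gt_atTop A.ncard)
    obtain ⟨n, hn, hn'⟩ := h1.exists
    have : countUpTo A n ≤ A.ncard := Set.ncard_le_ncard Set.inter_subset_left hfin
    omega
  obtain ⟨N, hN⟩ := eventually_atTop.1 hev
  have hQ : ∀ n : ℕ, (countUpTo (sharedPrimes A) n : ℝ) ≤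
      countUpTo (A ∩ integersOver (sharedPrimes A)) n + N := by
    intro n
    by_cases hn : N ≤ n
    · have h1 := countUpTo_add_countUpTo_sharedPrimes_le (A := A) n
      have h2 := hN n hn
      exact_mod_cast (by omega : countUpTo (sharedPrimes A) n ≤
        countUpTo (A ∩ integersOver (sharedPrimes A)) n + N)
    · have : countUpTo (sharedPrimes A) n ≤ n := by
        classical
        rw [countUpTo_eq_card]
        exact (Finset.card_filter_le _ _).trans (by simp)
      exact_mod_cast (by omega : countUpTo (sharedPrimes A) n ≤
        countUpTo (A ∩ integersOver (sharedPrimes A)) n + N)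
  obtain ⟨k, hk⟩ := exists_pow_lt_of_lt_one hε (by norm_num : (4 / 5 : ℝ) < 1)
  obtain ⟨C, hC, hB⟩ := exists_countUpTo_le_rpow hA hh hinf hQ k
  refine ⟨C, Eventually.frequently ((eventually_ge_atTop 1).mono fun n hn => ?_)⟩
  have hn1 : (1 : ℝ) ≤ n := by exact_mod_cast hn
  rw [div_le_iff₀ (by positivity)]
  have h1 : (countUpTo A n : ℝ) + countUpTo (sharedPrimes A) n ≤
      n.primeCounting + countUpTo (A ∩ integersOver (sharedPrimes A)) n := by
    exact_mod_cast countUpTo_add_countUpTo_sharedPrimes_le n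
  have h2 := mul_le_mul_of_nonneg_left (Real.rpow_le_rpow_of_exponent_le hn1 hk.le) hC
  have h3 : (0 : ℝ) ≤ countUpTo (sharedPrimes A) n := Nat.cast_nonneg _
  linarith [hB n hn]

/-! ### Blocks of products of primes from Reed–Solomon codes -/

/-- A sufficient condition for property `P_h`: an element dividing a product of `h` others would
share at least `1 / h` of its prime factors with one of them. -/
lemma hasPropertyP_of_card_primeFactors_inter_le {h : ℕ} {A : Set ℕ} (hA0 : 0 ∉ A)
    (hA : ∀ a ∈ A, ∃ D, h * D < a.primeFactors.card ∧
      ∀ b ∈ A, b ≠ a → (a.primeFactors ∩ b.primeFactors).card ≤ D) : HasPropertyP h A := by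
  intro a ha s hsA hsh has hdvd
  obtain ⟨D, hD, hAD⟩ := hA a ha
  have hsub : a.primeFactors ⊆ s.biUnion fun b => a.primeFactors ∩ b.primeFactors := by
    intro p hp
    have hpp := Nat.prime_of_mem_primeFactors hp
    obtain ⟨b, hb, hpb⟩ := (Prime.dvd_finsetProd_iff hpp.prime _).1
      ((Nat.dvd_of_mem_primeFactors hp).trans hdvd)
    refine Finset.mem_biUnion.2 ⟨b, hb, Finset.mem_inter.2 ⟨hp, ?_⟩⟩
    exact Nat.mem_primeFactors.2 ⟨hpp, hpb, fun h0 => hA0 (h0 ▸ hsA hb)⟩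
  have h1 := (Finset.card_le_card hsub).trans (Finset.card_biUnion_le_card_mul s _ D
    fun b hb => hAD b (hsA hb) (fun hba => has (hba ▸ hb)))
  rw [hsh] at h1
  omega

open Polynomial in
/-- Reed–Solomon codes over the field with `2 ^ m` elements: the words are the values at `k`
points of the polynomials of degree at most `D`. -/
lemma exists_code {m D k : ℕ} (hm : m ≠ 0) (hD : D < k) (hk : k ≤ 2 ^ m) :
    ∃ W : Finset (Fin k → Fin (2 ^ m)), W.card = 2 ^ (m * (D + 1)) ∧
      ∀ f ∈ W, ∀ g ∈ W, f ≠ g → (Finset.univ.filter fun i => f i = g i).card ≤ D := by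
  classical
  let F := GaloisField 2 m
  have : Fintype F := Fintype.ofFinite F
  have hF : Fintype.card F = 2 ^ m := by rw [← Nat.card_eq_fintype_card, GaloisField.card 2 m hm]
  let e : F ≃ Fin (2 ^ m) := Fintype.equivFinOfCardEq hF
  let x : Fin k → F := fun i => e.symm (Fin.castLE hk i)
  have hx : Function.Injective x := e.symm.injective.comp (Fin.castLE_injective hk)
  let P : (Fin (D + 1) → F) → degreeLT F (D + 1) := (degreeLTEquiv F (D + 1)).symm
  have hP : Function.Injective P := (degreeLTEquiv F (D + 1)).symm.injective
  let Φ : (Fin (D + 1) → F) → Fin k → Fin (2 ^ m) := fun c i => e ((P c).1.eval (x i))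
  have hΦ : ∀ c c', D < (Finset.univ.filter fun i => Φ c i = Φ c' i).card → c = c' := by
    intro c c' hcard
    apply hP
    apply Subtype.ext
    refine Polynomial.eq_of_degrees_lt_of_eval_index_eq
      (Finset.univ.filter fun i => Φ c i = Φ c' i) (v := x) hx.injOn ?_ ?_ ?_
    · exact (mem_degreeLT.1 (P c).2).trans_le (by exact_mod_cast hcard)
    · exact (mem_degreeLT.1 (P c').2).trans_le (by exact_mod_cast hcard)
    · intro i hi
      exact e.injective (Finset.mem_filter.1 hi).2
  have hinj : Function.Injective Φ := by
    intro c c' hcc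
    apply hΦ
    simp [hcc, hD]
  refine ⟨Finset.univ.image Φ, ?_, ?_⟩
  · rw [Finset.card_image_of_injective _ hinj]
    simp [hF, pow_mul]
  · intro f hf g hg hne
    obtain ⟨c, -, rfl⟩ := Finset.mem_image.1 hf
    obtain ⟨c', -, rfl⟩ := Finset.mem_image.1 hg
    by_contra! hlt
    exact hne (congrArg Φ (hΦ c c' hlt))

/-- A set of `k * 2 ^ m` primes, split into `k` classes of `2 ^ m`, turns a code into a set of
integers: a word selects one prime in each class. -/
lemma exists_integers_of_code {m D k Y : ℕ} (hm : m ≠ 0) (hD : D < k) (hk : k ≤ 2 ^ m)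
    {T : Finset ℕ} (hT : T.card = k * 2 ^ m) (hTp : ∀ p ∈ T, p.Prime) (hTY : ∀ p ∈ T, p ≤ Y) :
    ∃ B : Finset ℕ, B.card = 2 ^ (m * (D + 1)) ∧
      (∀ b ∈ B, b ≠ 0 ∧ b ≤ Y ^ k ∧ b.primeFactors ⊆ T ∧ b.primeFactors.card = k) ∧
      ∀ b ∈ B, ∀ c ∈ B, b ≠ c → (b.primeFactors ∩ c.primeFactors).card ≤ D := by
  classical
  obtain ⟨W, hWc, hW⟩ := exists_code hm hD hk
  have hcard : Fintype.card (Fin k × Fin (2 ^ m)) = Fintype.card T := by simp [hT]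
  let q : Fin k × Fin (2 ^ m) ≃ T := Fintype.equivOfCardEq hcard
  have hq : Function.Injective fun z => (q z : ℕ) := Subtype.val_injective.comp q.injective
  let S : (Fin k → Fin (2 ^ m)) → Finset ℕ := fun f => Finset.univ.image fun i => (q (i, f i) : ℕ)
  have hST : ∀ f, S f ⊆ T := by
    intro f p hp
    obtain ⟨i, -, rfl⟩ := Finset.mem_image.1 hp
    exact (q (i, f i)).2
  have hSc : ∀ f, (S f).card = k := by
    intro f
    rw [Finset.card_image_of_injective]
    · simp
    · intro i j hij
      exact congrArg Prod.fst (hq hij)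
  have hpf : ∀ f, (∏ p ∈ S f, p).primeFactors = S f := fun f =>
    Nat.primeFactors_prod fun p hp => hTp p (hST f hp)
  have hinter : ∀ f g, S f ∩ S g ⊆
      (Finset.univ.filter fun i => f i = g i).image fun i => (q (i, f i) : ℕ) := by
    intro f g p hp
    obtain ⟨h1, h2⟩ := Finset.mem_inter.1 hp
    obtain ⟨i, -, rfl⟩ := Finset.mem_image.1 h1
    obtain ⟨j, -, hj⟩ := Finset.mem_image.1 h2
    have hz := hq hj
    simp only [Prod.mk.injEq] at hz
    obtain ⟨rfl, hz⟩ := hz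
    exact Finset.mem_image.2 ⟨j, by simp [hz], rfl⟩
  have hinj : Set.InjOn (fun f => ∏ p ∈ S f, p) (W : Set (Fin k → Fin (2 ^ m))) := by
    intro f hf g hg hfg
    have hS : S f = S g := by rw [← hpf f, ← hpf g]; exact congrArg _ hfg
    by_contra hne
    have h1 := (Finset.card_le_card (hinter f g)).trans Finset.card_image_le
    have h2 := hW f hf g hg hne
    rw [hS, Finset.inter_self, hSc] at h1
    omega
  refine ⟨W.image fun f => ∏ p ∈ S f, p, ?_, ?_, ?_⟩
  · rw [Finset.card_image_of_injOn hinj, hWc]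
  · intro b hb
    obtain ⟨f, -, rfl⟩ := Finset.mem_image.1 hb
    refine ⟨Finset.prod_ne_zero_iff.2 fun p hp => (hTp p (hST f hp)).ne_zero, ?_, ?_, ?_⟩
    · calc ∏ p ∈ S f, p ≤ Y ^ (S f).card := Finset.prod_le_pow_card _ _ _ fun p hp =>
          hTY p (hST f hp)
        _ = Y ^ k := by rw [hSc]
    · rw [hpf]; exact hST f
    · rw [hpf, hSc]
  · intro b hb c hc hne
    obtain ⟨f, hf, rfl⟩ := Finset.mem_image.1 hb
    obtain ⟨g, hg, rfl⟩ := Finset.mem_image.1 hc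
    rw [hpf, hpf]
    exact (Finset.card_le_card (hinter f g)).trans (Finset.card_image_le.trans
      (hW f hf g hg fun hfg => hne (by rw [hfg])))

/-- Chebyshev's lower bound for `π` provides `2 ^ L` primes in `(2 ^ L, 2 ^ (2 * L)]`. -/
lemma exists_primes_between {L N : ℕ} (hL : 5 ≤ L) (hN : N ≤ 2 ^ L) :
    ∃ T : Finset ℕ, T.card = N ∧ ∀ p ∈ T, p.Prime ∧ 2 ^ L < p ∧ p ≤ (2 ^ L) ^ 2 := by
  classical
  let S := (Finset.Ioc (2 ^ L) ((2 ^ L) ^ 2)).filter Nat.Prime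
  suffices h : N ≤ S.card by
    obtain ⟨T, hTS, hT⟩ := Finset.exists_subset_card_eq h
    refine ⟨T, hT, fun p hp => ?_⟩
    have := hTS hp
    simp only [S, Finset.mem_filter, Finset.mem_Ioc] at this
    exact ⟨this.2, this.1⟩
  have h1 : ((2 ^ L) ^ 2).primeCounting ≤ 2 ^ L + S.card := by
    rw [← Nat.primesLE_card_eq_primeCounting]
    have hsub : Nat.primesLE ((2 ^ L) ^ 2) ⊆ Finset.Icc 1 (2 ^ L) ∪ S := by
      intro p hp
      rw [Nat.mem_primesLE] at hp
      have := hp.2.one_lt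
      simp only [S, Finset.mem_union, Finset.mem_Icc, Finset.mem_filter, Finset.mem_Ioc]
      by_cases h : p ≤ 2 ^ L
      · exact Or.inl ⟨by omega, h⟩
      · exact Or.inr ⟨⟨by omega, hp.1⟩, hp.2⟩
    refine (Finset.card_le_card hsub).trans ((Finset.card_union_le _ _).trans ?_)
    simp
  have hgrow : ∀ n : ℕ, 5 ≤ n → 4 * n + 1 ≤ 2 ^ n := by
    intro n hn
    induction n, hn using Nat.le_induction with
    | base => norm_num
    | succ n hn ih => rw [pow_succ]; omega
  have h2 : 2 * 2 ^ L ≤ ((2 ^ L) ^ 2).primeCounting := by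
    have hpi := Chebyshev.pi_ge ((2 ^ L) ^ 2)
    have hlog2 : 0 < Real.log 2 := Real.log_pos one_lt_two
    have hL0 : (0 : ℝ) < L := by exact_mod_cast (by omega : 0 < L)
    have e1 : Real.log (((2 ^ L) ^ 2 : ℕ) : ℝ) = 2 * L * Real.log 2 := by
      push_cast
      rw [Real.log_pow, Real.log_pow]
      push_cast
      ring
    have e2 : Real.log ((((2 ^ L) ^ 2 : ℕ) : ℝ) + 1) ≤ (2 * L + 1) * Real.log 2 := by
      have : (((2 ^ L) ^ 2 : ℕ) : ℝ) + 1 ≤ 2 ^ (2 * L + 1) := by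
        have : (2 ^ L) ^ 2 + 1 ≤ 2 ^ (2 * L + 1) := by
          have e3 : 2 ^ (2 * L + 1) = 2 * (2 ^ L) ^ 2 := by ring
          rw [e3]
          have := Nat.one_le_pow 2 (2 ^ L) (by positivity)
          omega
        exact_mod_cast this
      calc Real.log ((((2 ^ L) ^ 2 : ℕ) : ℝ) + 1) ≤ Real.log (2 ^ (2 * L + 1)) :=
            Real.log_le_log (by positivity) this
        _ = (2 * L + 1) * Real.log 2 := by rw [Real.log_pow]; push_cast; ring
    have hg : (4 * L + 1 : ℝ) ≤ 2 ^ L := by exact_mod_cast hgrow L hL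
    have hkey : (2 * 2 ^ L : ℝ) * (2 * L) + (2 * L + 1) ≤ (2 ^ L) ^ 2 := by nlinarith
    have : (2 * 2 ^ L : ℝ) ≤ ((2 ^ L) ^ 2).primeCounting := by
      refine le_trans ?_ hpi
      rw [e1, le_div_iff₀ (by positivity)]
      have := mul_le_mul_of_nonneg_right hkey hlog2.le
      push_cast at e2 ⊢
      nlinarith
    exact_mod_cast this
  omega

/-! ### The choice of scales and the lower bound -/

lemma pow_le_two_pow_pow {H j : ℕ} (hH : 8 ≤ H) (hj : 2 ≤ j) :
    H ^ (3 * j + 5) ≤ 2 ^ H ^ j ^ 2 := by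
  have h1 : ∀ n : ℕ, 2 ≤ n → 3 * n + 5 ≤ 8 ^ n := by
    intro n hn
    induction n, hn using Nat.le_induction with
    | base => norm_num
    | succ n hn ih => rw [pow_succ]; omega
  calc H ^ (3 * j + 5) ≤ (2 ^ H) ^ (3 * j + 5) := Nat.pow_le_pow_left Nat.lt_two_pow_self.le _
    _ = 2 ^ (H * (3 * j + 5)) := by rw [pow_mul]
    _ ≤ 2 ^ H ^ j ^ 2 := by
        refine Nat.pow_le_pow_right two_pos ?_
        calc H * (3 * j + 5) ≤ H * H ^ j :=
              Nat.mul_le_mul_left _ ((h1 j hj).trans (Nat.pow_le_pow_left hH j))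
          _ = H ^ (j + 1) := by ring
          _ ≤ H ^ j ^ 2 := Nat.pow_le_pow_right (by omega) (by nlinarith)

/-- One block of the construction, at scale `2 ^ L` with `L = H ^ (j ^ 2 + j)` and `H = 4 * h`.
The bound for `T.card` is little more than `2 ^ m`, where `m = H ^ (j ^ 2)`. The set `B` comes from
polynomials of degree at most `D = H ^ (2 * j + 1)`, so that `m * D` is the `m` of the next block and
`B` has more elements than the sets `T` of all the blocks up to the next. Each element of `B` has
`h * D + 1` prime factors and lies below the scale of the next block. -/
lemma exists_block {h H : ℕ} (hh : 2 ≤ h) (hH : H = 4 * h) {j : ℕ} (hj : 2 ≤ j) :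
    ∃ T B : Finset ℕ,
      T.card ≤ H ^ (2 * j + 2) * 2 ^ H ^ j ^ 2 ∧
      (∀ p ∈ T, p.Prime ∧ 2 ^ H ^ (j ^ 2 + j) < p ∧
        p ≤ 2 ^ H ^ ((j + 1) ^ 2 + (j + 1))) ∧
      B.card = 2 ^ (H ^ (j + 1) ^ 2 + H ^ j ^ 2) ∧
      (∀ b ∈ B, b ≠ 0 ∧ b ≤ 2 ^ H ^ ((j + 1) ^ 2 + (j + 1)) ∧ b.primeFactors ⊆ T ∧
        b.primeFactors.card = h * H ^ (2 * j + 1) + 1) ∧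
      ∀ b ∈ B, ∀ c ∈ B, b ≠ c →
        (b.primeFactors ∩ c.primeFactors).card ≤ H ^ (2 * j + 1) := by
  have hH8 : 8 ≤ H := by omega
  have hpos : 0 < H ^ (2 * j + 1) := by positivity
  have hk : h * H ^ (2 * j + 1) + 1 ≤ H ^ (2 * j + 2) := by
    rw [pow_succ H (2 * j + 1)]
    nth_rw 3 [hH]
    nlinarith
  have hk2 : 2 * (h * H ^ (2 * j + 1) + 1) ≤ H ^ (2 * j + 2) := by
    rw [pow_succ H (2 * j + 1)]
    nth_rw 3 [hH]
    nlinarith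
  have hkm : h * H ^ (2 * j + 1) + 1 ≤ 2 ^ H ^ j ^ 2 :=
    hk.trans ((Nat.pow_le_pow_right (by omega) (by omega)).trans (pow_le_two_pow_pow hH8 hj))
  have hL5 : 5 ≤ H ^ (j ^ 2 + j) := by
    calc 5 ≤ H ^ 1 := by rw [pow_one]; omega
      _ ≤ H ^ (j ^ 2 + j) := Nat.pow_le_pow_right (by omega) (by nlinarith)
  have hmL : 2 * H ^ j ^ 2 ≤ H ^ (j ^ 2 + j) := by
    rw [pow_add, mul_comm]
    refine Nat.mul_le_mul_left _ ?_
    calc 2 ≤ H ^ 1 := by rw [pow_one]; omega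
      _ ≤ H ^ j := Nat.pow_le_pow_right (by omega) (by omega)
  have hLL : H ^ ((j + 1) ^ 2 + (j + 1)) = H ^ (j ^ 2 + j) * H ^ (2 * j + 2) := by
    rw [← pow_add]; congr 1; ring
  obtain ⟨T, hTc, hT⟩ := exists_primes_between (L := H ^ (j ^ 2 + j))
    (N := (h * H ^ (2 * j + 1) + 1) * 2 ^ H ^ j ^ 2) hL5 (by
      calc (h * H ^ (2 * j + 1) + 1) * 2 ^ H ^ j ^ 2 ≤ 2 ^ H ^ j ^ 2 * 2 ^ H ^ j ^ 2 :=
            Nat.mul_le_mul_right _ hkm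
        _ = 2 ^ (2 * H ^ j ^ 2) := by rw [← pow_add, two_mul]
        _ ≤ 2 ^ H ^ (j ^ 2 + j) := Nat.pow_le_pow_right two_pos hmL)
  obtain ⟨B, hBc, hB, hBB⟩ := exists_integers_of_code (m := H ^ j ^ 2) (D := H ^ (2 * j + 1))
    (by positivity) (by nlinarith) hkm hTc (fun p hp => (hT p hp).1) (fun p hp => (hT p hp).2.2)
  refine ⟨T, B, ?_, ?_, ?_, ?_, hBB⟩
  · rw [hTc]
    exact Nat.mul_le_mul_right _ hk
  · refine fun p hp => ⟨(hT p hp).1, (hT p hp).2.1, (hT p hp).2.2.trans ?_⟩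
    rw [← pow_mul, hLL]
    exact Nat.pow_le_pow_right two_pos (Nat.mul_le_mul_left _ (by omega))
  · rw [hBc]
    congr 1
    ring
  · refine fun b hb => ⟨(hB b hb).1, (hB b hb).2.1.trans ?_, (hB b hb).2.2⟩
    rw [← pow_mul, ← pow_mul, hLL]
    exact Nat.pow_le_pow_right two_pos (Nat.mul_le_mul_left _ hk2)

/-- Between the scales of the blocks `j + 1` and `j + 2` the required gain is at most
`2 ^ (H ^ ((j + 1) ^ 2))`. The exponents of `2` in the upper bound for `n` and in the gain have
quotient `H ^ (3 * j + 5)`, while `√(log h * log log n)` is at least `(j + 1) * log H / 2`; hence the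
constant `10`. -/
lemma exp_log_rpow_le {h H j n : ℕ} (hh : 2 ≤ h) (hH : H = 4 * h)
    (hn : 2 ^ H ^ ((j + 1) ^ 2 + (j + 1)) ≤ n) (hn' : n < 2 ^ H ^ ((j + 2) ^ 2 + (j + 2))) :
    Real.exp (Real.log n ^ (1 - 10 * Real.sqrt (Real.log h) / Real.sqrt (Real.log (Real.log n))))
      ≤ 2 ^ H ^ (j + 1) ^ 2 := by
  have hhR : (2 : ℝ) ≤ h := by exact_mod_cast hh
  have hH8 : (8 : ℝ) ≤ H := by exact_mod_cast (by omega : 8 ≤ H)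
  have hH0 : (0 : ℝ) < H := by linarith
  have hlogH : 0 < Real.log H := Real.log_pos (by linarith)
  have hlogh : 0 < Real.log h := Real.log_pos (by linarith)
  have hl2 := Real.log_two_gt_d9
  have hnR : (2 : ℝ) ^ H ^ ((j + 1) ^ 2 + (j + 1)) ≤ n := by exact_mod_cast hn
  have hnR' : (n : ℝ) ≤ 2 ^ H ^ ((j + 2) ^ 2 + (j + 2)) := by exact_mod_cast hn'.le
  have hn0 : (0 : ℝ) < n := lt_of_lt_of_le (by positivity) hnR
  have hx1 : (H : ℝ) ^ ((j + 1) ^ 2 + (j + 1)) * Real.log 2 ≤ Real.log n := by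
    have := Real.log_le_log (by positivity) hnR
    rw [Real.log_pow] at this
    exact_mod_cast this
  have hx2 : Real.log n ≤ (H : ℝ) ^ ((j + 2) ^ 2 + (j + 2)) * Real.log 2 := by
    have := Real.log_le_log hn0 hnR'
    rw [Real.log_pow] at this
    exact_mod_cast this
  have hx3 : (H : ℝ) ^ (j + 1) ^ 2 ≤ Real.log n := by
    refine le_trans ?_ hx1
    rw [pow_add, mul_assoc]
    refine le_mul_of_one_le_right (by positivity) ?_
    have : (H : ℝ) ^ 1 ≤ H ^ (j + 1) := pow_le_pow_right₀ (by linarith) (by omega)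
    nlinarith
  have hx0 : 0 < Real.log n := lt_of_lt_of_le (by positivity) hx3
  set t := Real.log (Real.log n) with ht
  have ht1 : ((j : ℝ) + 1) ^ 2 * Real.log H ≤ t := by
    have := Real.log_le_log (by positivity) hx3
    rw [Real.log_pow] at this
    exact_mod_cast this
  have ht0 : 0 < t := lt_of_lt_of_le (by positivity) ht1
  -- `4 * h ≤ h ^ 3`
  have hH3 : Real.log H ≤ 3 * Real.log h := by
    have : (H : ℝ) ≤ (h : ℝ) ^ 3 := by rw [hH]; push_cast; nlinarith [mul_nonneg (by positivity : (0 : ℝ) ≤ h * (h + 2)) (sub_nonneg.2 hhR)]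
    have := Real.log_le_log hH0 this
    rw [Real.log_pow] at this
    exact_mod_cast this
  have hsq : ((j : ℝ) + 1) * Real.log H / 2 ≤ Real.sqrt (Real.log h) * Real.sqrt t := by
    rw [← Real.sqrt_mul hlogh.le]
    refine Real.le_sqrt_of_sq_le ?_
    calc (((j : ℝ) + 1) * Real.log H / 2) ^ 2
        = (Real.log H / 4) * (((j : ℝ) + 1) ^ 2 * Real.log H) := by ring
      _ ≤ Real.log h * t := mul_le_mul (by linarith) ht1 (by positivity) hlogh.le
  have hexp : Real.log n ^ (1 - 10 * Real.sqrt (Real.log h) / Real.sqrt t) ≤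
      (H : ℝ) ^ (j + 1) ^ 2 * Real.log 2 := by
    have hst : 0 < Real.sqrt t := Real.sqrt_pos.2 ht0
    have e1 : t * (1 - 10 * Real.sqrt (Real.log h) / Real.sqrt t) =
        t - 10 * (Real.sqrt (Real.log h) * Real.sqrt t) := by
      nth_rw 1 [← Real.mul_self_sqrt ht0.le]
      nth_rw 4 [← Real.mul_self_sqrt ht0.le]
      field_simp
    rw [Real.rpow_def_of_pos hx0, ← ht, e1, Real.exp_sub, ht, Real.exp_log hx0,
      div_le_iff₀ (Real.exp_pos _)]
    have e2 : (H : ℝ) ^ (3 * j + 5) ≤ Real.exp (10 * (Real.sqrt (Real.log h) * Real.sqrt t)) := by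
      rw [← Real.log_le_iff_le_exp (by positivity), Real.log_pow]
      push_cast
      have : (0 : ℝ) ≤ j * Real.log H := by positivity
      nlinarith
    calc Real.log n ≤ (H : ℝ) ^ ((j + 2) ^ 2 + (j + 2)) * Real.log 2 := hx2
      _ = (H : ℝ) ^ (j + 1) ^ 2 * Real.log 2 * H ^ (3 * j + 5) := by ring
      _ ≤ _ := mul_le_mul_of_nonneg_left e2 (by positivity)
  calc _ ≤ Real.exp ((H : ℝ) ^ (j + 1) ^ 2 * Real.log 2) := Real.exp_le_exp.2 hexp
    _ = 2 ^ H ^ (j + 1) ^ 2 := by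
        rw [← Real.exp_log (by positivity : (0 : ℝ) < 2 ^ H ^ (j + 1) ^ 2), Real.log_pow]
        push_cast
        rfl

theorem exists_hasPropertyP_primeCounting_add_exp_le {h : ℕ} (hh : 2 ≤ h) :
    ∃ A ∈ propertyPSets h posInts, ∀ᶠ n : ℕ in atTop,
      (Nat.primeCounting n : ℝ) +
          Real.exp (Real.log n ^
            (1 - 10 * Real.sqrt (Real.log h) / Real.sqrt (Real.log (Real.log n))))
        ≤ (countUpTo A n : ℝ) := by
  classical
  obtain ⟨H, hH⟩ : ∃ H, H = 4 * h := ⟨_, rfl⟩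
  have hH8 : 8 ≤ H := by omega
  have hblock : ∀ j, ∃ T B : Finset ℕ, 2 ≤ j → _ := fun j =>
    if hj : 2 ≤ j then by
      obtain ⟨T, B, hTB⟩ := exists_block hh hH hj
      exact ⟨T, B, fun _ => hTB⟩
    else ⟨∅, ∅, fun hj' => absurd hj' hj⟩
  choose T B hTB using hblock
  let e : ℕ → ℕ := fun j => H ^ (j ^ 2 + j)
  have he : ∀ j, e j = H ^ (j ^ 2 + j) := fun j => rfl
  have hemono : StrictMono e := by
    refine fun i j hij => Nat.pow_lt_pow_right (by omega) ?_
    nlinarith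
  have hdisj : ∀ i j p, 2 ≤ i → 2 ≤ j → p ∈ T i → p ∈ T j → i = j := by
    have key : ∀ i j p, 2 ≤ i → 2 ≤ j → p ∈ T i → p ∈ T j → ¬ i < j := by
      intro i j p hi hj hpi hpj hij
      have h1 := ((hTB i hi).2.1 p hpi).2.2
      have h2 := ((hTB j hj).2.1 p hpj).2.1
      have h3 : 2 ^ e (i + 1) ≤ 2 ^ e j := Nat.pow_le_pow_right two_pos (hemono.monotone hij)
      simp only [he] at h3
      omega
    intro i j p hi hj hpi hpj
    have := key i j p hi hj hpi hpj
    have := key j i p hj hi hpj hpi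
    omega
  let A : Set ℕ := {a | (a.Prime ∧ ∀ j, 2 ≤ j → a ∉ T j) ∨ ∃ j, 2 ≤ j ∧ a ∈ B j}
  have hA0 : ∀ a ∈ A, a ≠ 0 := by
    rintro a (⟨ha, -⟩ | ⟨j, hj, ha⟩)
    · exact ha.ne_zero
    · exact ((hTB j hj).2.2.2.1 a ha).1
  refine ⟨A, ⟨fun a ha => Nat.pos_of_ne_zero (hA0 a ha), ?_⟩, ?_⟩
  · refine hasPropertyP_of_card_primeFactors_inter_le (fun h0 => hA0 0 h0 rfl) ?_
    rintro a (⟨ha, haT⟩ | ⟨j, hj, ha⟩)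
    · refine ⟨0, by simp [ha.primeFactors], ?_⟩
      rintro b (⟨hb, -⟩ | ⟨i, hi, hb⟩) hne
      · simp [ha.primeFactors, hb.primeFactors, hne.symm]
      · have hab : a ∉ b.primeFactors := fun hab =>
          haT i hi (((hTB i hi).2.2.2.1 b hb).2.2.1 hab)
        simp [ha.primeFactors, Finset.singleton_inter_of_notMem hab]
    · obtain ⟨-, -, haT, hac⟩ := (hTB j hj).2.2.2.1 a ha
      refine ⟨H ^ (2 * j + 1), by omega, ?_⟩
      rintro b (⟨hb, hbT⟩ | ⟨i, hi, hb⟩) hne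
      · have hba : b ∉ a.primeFactors := fun hba => hbT j hj (haT hba)
        simp [hb.primeFactors, Finset.inter_singleton_of_notMem hba]
      · by_cases hij : i = j
        · subst hij
          exact (hTB i hi).2.2.2.2 a ha b hb hne.symm
        · have : a.primeFactors ∩ b.primeFactors = ∅ := by
            by_contra hcon
            obtain ⟨p, hp⟩ := Finset.nonempty_iff_ne_empty.2 hcon
            rw [Finset.mem_inter] at hp
            exact hij (hdisj i j p hi hj (((hTB i hi).2.2.2.1 b hb).2.2.1 hp.2) (haT hp.1))
          simp [this]
  · filter_upwards [eventually_ge_atTop (2 ^ e 3)] with n hn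
    obtain ⟨j, hj, hjn, hnj⟩ : ∃ j, 2 ≤ j ∧ 2 ^ e (j + 1) ≤ n ∧ n < 2 ^ e (j + 2) := by
      have hex : ∃ t, n < 2 ^ e t :=
        ⟨n, Nat.lt_two_pow_self.trans_le (Nat.pow_le_pow_right two_pos hemono.le_apply)⟩
      have h1 := Nat.find_spec hex
      have h4 : 3 < Nat.find hex := by
        by_contra! hle
        have : 2 ^ e (Nat.find hex) ≤ 2 ^ e 3 :=
          Nat.pow_le_pow_right two_pos (hemono.monotone hle)
        omega
      have h2 := Nat.find_min hex (m := Nat.find hex - 1) (by omega)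
      refine ⟨Nat.find hex - 2, by omega, ?_, ?_⟩
      · rw [show Nat.find hex - 2 + 1 = Nat.find hex - 1 by omega]
        exact not_lt.1 h2
      · rwa [show Nat.find hex - 2 + 2 = Nat.find hex by omega]
    -- the primes up to `n` that are missing from `A` lie in the blocks up to `j + 1`, and `B j`
    -- alone makes up for them
    obtain ⟨-, -, hBc, hB, -⟩ := hTB j hj
    set U := (Finset.Icc 2 (j + 1)).biUnion T with hU
    have hUc : U.card ≤ j * (H ^ (2 * j + 4) * 2 ^ H ^ (j + 1) ^ 2) := by
      refine (Finset.card_biUnion_le_card_mul _ _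
        (H ^ (2 * j + 4) * 2 ^ H ^ (j + 1) ^ 2) fun t ht => ?_).trans_eq (by simp)
      obtain ⟨ht2, htj⟩ := Finset.mem_Icc.1 ht
      refine (hTB t ht2).1.trans (Nat.mul_le_mul (Nat.pow_le_pow_right (by omega) (by omega)) ?_)
      exact Nat.pow_le_pow_right two_pos (Nat.pow_le_pow_right (by omega)
        (Nat.pow_le_pow_left htj 2))
    have hcount : n.primeCounting + (B j).card ≤ countUpTo A n + U.card := by
      rw [← Nat.primesLE_card_eq_primeCounting, countUpTo_eq_card]
      have hd : Disjoint (n.primesLE \ U) (B j) := by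
        rw [Finset.disjoint_left]
        intro p hp hpB
        have hpp := (Nat.mem_primesLE.1 (Finset.mem_sdiff.1 hp).1).2
        have h1 := (hB p hpB).2.2.2
        rw [hpp.primeFactors, Finset.card_singleton] at h1
        have : 0 < h * H ^ (2 * j + 1) := by positivity
        omega
      have hs : (n.primesLE \ U) ∪ B j ⊆ (Finset.Icc 1 n).filter (· ∈ A) := by
        intro a ha
        rw [Finset.mem_filter, Finset.mem_Icc]
        rcases Finset.mem_union.1 ha with ha | ha
        · obtain ⟨h1, h2⟩ := Finset.mem_sdiff.1 ha
          obtain ⟨han, hap⟩ := Nat.mem_primesLE.1 h1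
          refine ⟨⟨hap.one_le, han⟩, Or.inl ⟨hap, fun t ht haT => ?_⟩⟩
          by_cases htj : t ≤ j + 1
          · exact h2 (Finset.mem_biUnion.2 ⟨t, Finset.mem_Icc.2 ⟨ht, htj⟩, haT⟩)
          · have h3 := ((hTB t ht).2.1 a haT).2.1
            have h4 : 2 ^ e (j + 2) ≤ 2 ^ e t :=
              Nat.pow_le_pow_right two_pos (hemono.monotone (by omega))
            rw [he t] at h4
            omega
        · obtain ⟨h1, h2, -⟩ := hB a ha
          exact ⟨⟨Nat.pos_of_ne_zero h1, h2.trans hjn⟩, Or.inr ⟨j, hj, ha⟩⟩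
      have h1 := Finset.card_le_card hs
      rw [Finset.card_union_of_disjoint hd] at h1
      have h2 := Finset.le_card_sdiff U n.primesLE
      omega
    have hsize : U.card + 2 ^ H ^ (j + 1) ^ 2 ≤ (B j).card := by
      rw [hBc, pow_add]
      have h1 : j * H ^ (2 * j + 4) + 1 ≤ 2 ^ H ^ j ^ 2 := by
        refine le_trans ?_ (pow_le_two_pow_pow hH8 hj)
        have h2 : j + 1 ≤ H ^ (j + 1) := (Nat.lt_pow_self (by omega)).le
        calc j * H ^ (2 * j + 4) + 1 ≤ (j + 1) * H ^ (2 * j + 4) := by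
              have : 0 < H ^ (2 * j + 4) := by positivity
              nlinarith
          _ ≤ H ^ (j + 1) * H ^ (2 * j + 4) := Nat.mul_le_mul_right _ h2
          _ = H ^ (3 * j + 5) := by rw [← pow_add]; congr 1; ring
      calc U.card + 2 ^ H ^ (j + 1) ^ 2
          ≤ 2 ^ H ^ (j + 1) ^ 2 * (j * H ^ (2 * j + 4) + 1) := by nlinarith
        _ ≤ _ := Nat.mul_le_mul_left _ h1
    have hgain := exp_log_rpow_le hh hH hjn hnj
    have hfin : (n.primeCounting : ℝ) + 2 ^ H ^ (j + 1) ^ 2 ≤ countUpTo A n := by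
      exact_mod_cast (by omega : n.primeCounting + 2 ^ H ^ (j + 1) ^ 2 ≤ countUpTo A n)
    linarith

theorem theorem8 :
    (∀ (h : ℕ), 2 ≤ h → ∀ A ∈ propertyPSets h posInts, ∀ ε : ℝ, 0 < ε →
      liminf (fun n : ℕ =>
        ((((countUpTo A n : ℝ) - (Nat.primeCounting n : ℝ)) / (n : ℝ) ^ ε : ℝ) : EReal)) atTop
        < ⊤) ∧
    (∃ c : ℝ, 0 < c ∧ ∀ (h : ℕ), 2 ≤ h → ∃ A ∈ propertyPSets h posInts,
      ∀ᶠ n : ℕ in atTop,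
        (Nat.primeCounting n : ℝ) +
            Real.exp (Real.log n ^
              (1 - c * Real.sqrt (Real.log h) / Real.sqrt (Real.log (Real.log n))))
          ≤ (countUpTo A n : ℝ)) := by
  refine ⟨fun h hh A hA ε hε => ?_, 10, by norm_num, fun h hh => ?_⟩
  · exact liminf_countUpTo_sub_primeCounting_lt_top hh hA.2 hε
  · exact exists_hasPropertyP_primeCounting_add_exp_le hh
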